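/- Let $k$ be a positive integer and let $\Lambda$ be a finitely aligned $k$-graph: $\Lambda$ is a countable category with a functor $d:\Lambda\to\mathbb N^k$ such that whenever $d(\lambda)=m+n$ there are unique $\mu,\nu\in\Lambda$ with $\lambda=\mu\nu$, $d(\mu)=m$, $d(\nu)=n$ (write $\lambda(0,m):=\mu$), and for all $\lambda,\mu\in\Lambda$ the set $$\Lambda^{\min}(\lambda,\mu):=\{(\lambda',\mu')\in\Lambda\times\Lambda : \lambda\lambda'=\mu\mu',\ d(\lambda\lambda')=d(\lambda)\vee d(\mu)\}$$ is finite. Let $r,s$ denote range and source. Vertices are the elements of $\Lambda^0=d^{-1}(0)$, and edges are the elements of $\Lambda^1=\bigcup_i d^{-1}(e_i)$, where $e_1,\dots,e_k$ is the standard basis. For a vertex $v$ and $X\subseteq\Lambda$, let $vX$ be the set of $\lambda\in X$ with $r(\lambda)=v$. A set $E\subseteq v\Lambda$ is exhaustive if for every $\lambda\in v\Lambda$ there is $\mu\in E$ with $\Lambda^{\min}(\lambda,\mu)\neq\emptyset$. Let $\operatorname{FE}(\Lambda^1)$ be the collection of all finite exhaustive sets $E\subseteq v\Lambda^1$, $v\in\Lambda^0$;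 such an $E$ is non-empty, and we write $r(E):=v$. For $f\in r(E)\Lambda$ put $$\operatorname{Ext}_\Lambda(f;E):=\{g\in s(f)\Lambda : (g,e')\in\Lambda^{\min}(f,e)\text{ for some }e\in E\text{ and some }e'\in\Lambda\}.$$ A set $\mathcal E\subseteq\operatorname{FE}(\Lambda^1)$ is efficient if * (E1) $E,F\in\mathcal E$ and $E\subseteq F$ imply $E=F$; * (E2) if $E\in\mathcal E$ and $f\in r(E)\Lambda^1\setminus E$, there is $F\in\mathcal E$ with $F\subseteq\operatorname{Ext}_\Lambda(f;E)$; * (E3) if $E\in\mathcal E$, $e\in E$, and $F\in\mathcal E$ with $r(F)=s(e)$, there is $G\in\mathcal E$ with $G\subseteq(E\setminus\{e\})\cup\{(ef)(0,d(f)):f\in F\}$. Its edge satiation is $\widehat{\mathcal E}:=\{E\in\operatorname{FE}(\Lambda^1): F\subseteq E\text{ for some }F\in\mathcal E\}$. A relative Cuntz–Krieger $(\Lambda;\mathcal E)$-family is a family of partial isometries $\{T_\lambda:\lambda\in\Lambda\}$ in a (not necessarily unital) $C^*$-algebra such that the $T_v$, $v\in\Lambda^0$, are mutually orthogonal projections;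 $T_\lambda T_\mu=T_{\lambda\mu}$ whenever $s(\lambda)=r(\mu)$; $T_\lambda^*T_\mu=\sum_{(\lambda',\mu')\in\Lambda^{\min}(\lambda,\mu)}T_{\lambda'}T_{\mu'}^*$ for all $\lambda,\mu\in\Lambda$; and $\prod_{e\in E}(T_{r(E)}-T_eT_e^*)=0$ for all $E\in\mathcal E$. It is universal if it generates its $C^*$-algebra and for every relative Cuntz–Krieger $(\Lambda;\mathcal E)$-family $\{S_\lambda\}$ in a $C^*$-algebra $B$ there is a $*$-homomorphism into $B$ that maps $T_\lambda$ to $S_\lambda$ for all $\lambda\in\Lambda$. **Proposition.** Let $\mathcal E\subseteq\operatorname{FE}(\Lambda^1)$ be efficient, and let $\{s_\lambda^{\mathcal E}:\lambda\in\Lambda\}$ be the universal relative Cuntz–Krieger $(\Lambda;\mathcal E)$-family. Then: 1. $s_v^{\mathcal E}\neq0$ for every $v\in\Lambda^0$. 2. For every $v\in\Lambda^0$ and every finite set $E\subseteq v\Lambda^1$, $E\in\widehat{\mathcal E}$ if and only if $\prod_{e\in E}\bigl(s_v^{\mathcal E}-s_e^{\mathcal E}(s_e^{\mathcal E})^*\bigr)=0$,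 where the product over $E=\emptyset$ is $s_v^{\mathcal E}$. -/

import Mathlib

open CategoryTheory

universe u v w

/-- A higher-rank graph of rank `k` (a `k`-graph) on the category `V`: a countable category with a
degree functor to the monoid `ℕ^k` that has the factorisation property.

The objects of `V` are the vertices (identified with the identity morphisms, i.e. the paths of
degree `0`), and a morphism `f : a ⟶ b` is a path with source `a` and range `b`. Hence the product
`μν` of paths with `s(μ) = r(ν)`, as it is written for higher-rank graphs, is `ν ≫ μ`. -/
structure KGraph (k : ℕ) (V : Type u) [Category.{v} V] where
  /-- the degree functor -/
  d : ∀ ⦃a b : V⦄, (a ⟶ b) → (Fin k → ℕ)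
  d_id : ∀ a : V, d (𝟙 a) = 0
  d_comp : ∀ ⦃a b c : V⦄ (ν : a ⟶ b) (μ : b ⟶ c), d (ν ≫ μ) = d μ + d ν
  /-- the category has countably many morphisms (hence countably many objects) -/
  countable : Countable (Σ a b : V, (a ⟶ b))
  /-- the factorisation property -/
  factor : ∀ ⦃a b : V⦄ (f : a ⟶ b) (m n : Fin k → ℕ), d f = m + n →
    ∃! p : (Σ c : V, (c ⟶ b) × (a ⟶ c)), p.2.2 ≫ p.2.1 = f ∧ d p.2.1 = m ∧ d p.2.2 = n

/-- The set `xΛ` of all paths with range `x`. -/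
abbrev PathsTo {V : Type u} [Category.{v} V] (x : V) : Type (max u v) := Σ a : V, (a ⟶ x)

/-- A collection of elements of `A` indexed by the paths. -/
abbrev PathFamily (V : Type u) [Category.{v} V] (A : Type w) : Type (max u v w) :=
  ∀ ⦃a b : V⦄, (a ⟶ b) → A

/-- The product `∏_{μ ∈ E} (T_x - T_μ T_μ^*)` over a finite set `E` of paths with range `x`.
For the families considered below the factors commute (`KGraph.IsTCKFamily.gap_commute`), so that
the order of the factors is irrelevant, and `T_x` is a unit for them, so that the initial factor
`T_x` is harmless; the product over the empty set is `T_x`. -/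
noncomputable def gapProd {V : Type u} [Category.{v} V] {A : Type w} [NonUnitalRing A] [Star A]
    (T : PathFamily V A) {x : V} (E : Finset (PathsTo x)) : A :=
  E.toList.foldr (fun μ p => (T (𝟙 x) - T μ.2 * star (T μ.2)) * p) (T (𝟙 x))

namespace KGraph

variable {k : ℕ} {V : Type u} [Category.{v} V] (Λ : KGraph k V)

/-- A path is an edge if its degree is one of the basis vectors of `ℕ^k`. -/
def IsEdge {a b : V} (f : a ⟶ b) : Prop := ∃ i : Fin k, Λ.d f = Pi.single i 1

/-- `Λ^min(μ, ν)` for two paths `μ, ν` with the same range: the pairs `(μ', ν')` of paths with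
`μμ' = νν'` and `d(μμ') = d(μ) ∨ d(ν)`. For paths with different ranges `Λ^min` is empty. -/
def minExt {a b x : V} (μ : a ⟶ x) (ν : b ⟶ x) : Set (Σ c : V, (c ⟶ a) × (c ⟶ b)) :=
  {p | p.2.1 ≫ μ = p.2.2 ≫ ν ∧ Λ.d (p.2.1 ≫ μ) = Λ.d μ ⊔ Λ.d ν}

/-- `Λ` is finitely aligned if all the sets `Λ^min(μ, ν)` are finite. -/
def FinitelyAligned : Prop :=
  ∀ ⦃a b x : V⦄ (μ : a ⟶ x) (ν : b ⟶ x), (Λ.minExt μ ν).Finite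

/-- A set `E` of paths with range `x` is exhaustive if every path with range `x` has a common
extension with some element of `E`. -/
def Exhaustive {x : V} (E : Set (PathsTo x)) : Prop :=
  ∀ μ : PathsTo x, ∃ ν ∈ E, (Λ.minExt μ.2 ν.2).Nonempty

/-- `x FE(Λ)`: the finite exhaustive subsets of `xΛ \ {x}`. -/
def FE (x : V) : Set (Finset (PathsTo x)) :=
  {E | (⟨x, 𝟙 x⟩ : PathsTo x) ∉ E ∧ Λ.Exhaustive (E : Set (PathsTo x))}

/-- `x FE(Λ¹)`: the finite exhaustive sets of edges with range `x`. -/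
def edgeFE (x : V) : Set (Finset (PathsTo x)) :=
  {E | E ∈ Λ.FE x ∧ ∀ e ∈ E, Λ.IsEdge e.2}

/-- `Ext(f; E) = {g ∈ s(f)Λ : fg ∈ MCE(f, e) for some e ∈ E}`. -/
def ext {a x : V} (f : a ⟶ x) (E : Set (PathsTo x)) : Set (PathsTo a) :=
  {g | ∃ e ∈ E, ∃ h : g.1 ⟶ e.1, (⟨g.1, g.2, h⟩ : Σ c : V, (c ⟶ a) × (c ⟶ e.1)) ∈ Λ.minExt f e.2}

/-- `{(ef)(0, d(f)) : f ∈ F}`, where `(ef)(0, d(f))` is the unique path `g` of degree `d(f)` such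
that `ef = gh` for some path `h`. -/
def pushFront {a x : V} (e : a ⟶ x) (F : Set (PathsTo a)) : Set (PathsTo x) :=
  {g | ∃ f ∈ F, Λ.d g.2 = Λ.d f.2 ∧ ∃ h : f.1 ⟶ g.1, h ≫ g.2 = f.2 ≫ e}

/-- Efficient subsets `𝓔` of `FE(Λ¹)`. As members of `FE(Λ¹)` are non-empty and have a range, a
subset of `FE(Λ¹)` is the same as a subset `𝓔 x` of `x FE(Λ¹)` for every vertex `x`. -/
structure IsEfficient (𝓔 : ∀ x : V, Set (Finset (PathsTo x))) : Prop where
  subset_edgeFE : ∀ x, 𝓔 x ⊆ Λ.edgeFE x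
  minimal : ∀ x, ∀ E ∈ 𝓔 x, ∀ F ∈ 𝓔 x, E ⊆ F → E = F
  ext_mem : ∀ x, ∀ E ∈ 𝓔 x, ∀ f : PathsTo x, Λ.IsEdge f.2 → f ∉ E →
    ∃ F ∈ 𝓔 f.1, (F : Set (PathsTo f.1)) ⊆ Λ.ext f.2 (E : Set (PathsTo x))
  push_mem : ∀ x, ∀ E ∈ 𝓔 x, ∀ e ∈ E, ∀ F ∈ 𝓔 e.1,
    ∃ G ∈ 𝓔 x, (G : Set (PathsTo x)) ⊆
      ((E : Set (PathsTo x)) \ {e}) ∪ Λ.pushFront e.2 (F : Set (PathsTo e.1))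

/-- The part at the vertex `x` of the edge satiation of `𝓔`: the members of `x FE(Λ¹)` that
contain a member of `𝓔`. -/
def edgeSatiation (𝓔 : ∀ x : V, Set (Finset (PathsTo x))) (x : V) : Set (Finset (PathsTo x)) :=
  {E | E ∈ Λ.edgeFE x ∧ ∃ F ∈ 𝓔 x, F ⊆ E}

/-- Toeplitz–Cuntz–Krieger `Λ`-families in a C⋆-algebra (for finitely aligned `Λ`, so that the sums
are finite). -/
structure IsTCKFamily {A : Type w} [NonUnitalCStarAlgebra A] (T : PathFamily V A) : Prop where
  partialIsometry : ∀ ⦃a b : V⦄ (μ : a ⟶ b), T μ * star (T μ) * T μ = T μ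
  projection : ∀ x : V, IsStarProjection (T (𝟙 x))
  orthogonal : ∀ x y : V, x ≠ y → T (𝟙 x) * T (𝟙 y) = 0
  mul : ∀ ⦃a b c : V⦄ (μ : b ⟶ c) (ν : a ⟶ b), T μ * T ν = T (ν ≫ μ)
  star_mul : ∀ ⦃a b x : V⦄ (μ : a ⟶ x) (ν : b ⟶ x),
    star (T μ) * T ν = ∑ᶠ p ∈ Λ.minExt μ ν, T p.2.1 * star (T p.2.2)
  star_mul_of_ne : ∀ ⦃a b x y : V⦄ (μ : a ⟶ x) (ν : b ⟶ y), x ≠ y → star (T μ) * T ν = 0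

/-- Relative Cuntz–Krieger `(Λ; 𝓔)`-families in a C⋆-algebra. -/
structure IsRelCKFamily (𝓔 : ∀ x : V, Set (Finset (PathsTo x))) {A : Type w}
    [NonUnitalCStarAlgebra A] (T : PathFamily V A) : Prop extends Λ.IsTCKFamily T where
  gapProd_eq_zero : ∀ x, ∀ E ∈ 𝓔 x, gapProd T E = 0

/-- `s` is a universal relative Cuntz–Krieger `(Λ; 𝓔)`-family in the C⋆-algebra `A`: it is such a
family, it generates `A` as a C⋆-algebra, and for every such family `T` in a C⋆-algebra `B` there
is a ⋆-homomorphism `A → B` that maps `s` to `T`. So `A` is (a copy of) `C*(Λ; 𝓔)`. See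
`exists_isUniversalFamily` for the existence. -/
structure IsUniversalFamily (𝓔 : ∀ x : V, Set (Finset (PathsTo x))) {A : Type w}
    [NonUnitalCStarAlgebra A] (s : PathFamily V A) : Prop where
  isRelCKFamily : Λ.IsRelCKFamily 𝓔 s
  generates : (NonUnitalStarAlgebra.adjoin ℂ
    {y : A | ∃ (a b : V) (μ : a ⟶ b), y = s μ}).topologicalClosure = ⊤
  lift : ∀ (B : Type (max u v)) [NonUnitalCStarAlgebra B] (T : PathFamily V B),
    Λ.IsRelCKFamily 𝓔 T → ∃ π : A →⋆ₙₐ[ℂ] B, ∀ ⦃a b : V⦄ (μ : a ⟶ b), π (s μ) = T μ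

variable {Λ}

/-- The range projections of a Toeplitz–Cuntz–Krieger family of a finitely aligned `k`-graph
commute. -/
theorem IsTCKFamily.range_commute (hΛ : Λ.FinitelyAligned) {A : Type w} [NonUnitalCStarAlgebra A]
    {T : PathFamily V A} (hT : Λ.IsTCKFamily T) {a b x : V} (μ : a ⟶ x) (ν : b ⟶ x) :
    Commute (T μ * star (T μ)) (T ν * star (T ν)) := by
  have key : T μ * star (T μ) * (T ν * star (T ν)) =
      ∑ p ∈ (hΛ μ ν).toFinset, T (p.2.1 ≫ μ) * star (T (p.2.1 ≫ μ)) := by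
    have h1 : T μ * star (T μ) * (T ν * star (T ν)) =
        T μ * (star (T μ) * T ν) * star (T ν) := by simp only [mul_assoc]
    rw [h1, hT.star_mul, finsum_mem_eq_finite_toFinset_sum _ (hΛ μ ν), Finset.mul_sum,
      Finset.sum_mul]
    refine Finset.sum_congr rfl fun p hp => ?_
    have hp' : p.2.1 ≫ μ = p.2.2 ≫ ν := ((hΛ μ ν).mem_toFinset.1 hp).1
    conv_rhs => rw [← hT.mul μ p.2.1]
    rw [show star (T μ * T p.2.1) = star (T p.2.2) * star (T ν) by
      rw [← StarMul.star_mul, hT.mul, hT.mul, hp']]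
    simp only [mul_assoc]
  have hs : star (T μ * star (T μ) * (T ν * star (T ν))) =
      T μ * star (T μ) * (T ν * star (T ν)) := by
    rw [key, star_sum]
    simp only [StarMul.star_mul, star_star]
  have h2 : star (T μ * star (T μ) * (T ν * star (T ν))) =
      T ν * star (T ν) * (T μ * star (T μ)) := by
    simp only [StarMul.star_mul, star_star]
  exact hs.symm.trans h2

/-- The factors of `gapProd` commute. -/
theorem IsTCKFamily.gap_commute (hΛ : Λ.FinitelyAligned) {A : Type w} [NonUnitalCStarAlgebra A]
    {T : PathFamily V A} (hT : Λ.IsTCKFamily T) {x : V} (μ ν : PathsTo x) :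
    Commute (T (𝟙 x) - T μ.2 * star (T μ.2)) (T (𝟙 x) - T ν.2 * star (T ν.2)) := by
  have hl : ∀ ρ : PathsTo x, T (𝟙 x) * (T ρ.2 * star (T ρ.2)) = T ρ.2 * star (T ρ.2) := fun ρ => by
    rw [← mul_assoc, hT.mul, Category.comp_id]
  have hr : ∀ ρ : PathsTo x, T ρ.2 * star (T ρ.2) * T (𝟙 x) = T ρ.2 * star (T ρ.2) := fun ρ => by
    have h := congrArg star (hl ρ)
    rwa [StarMul.star_mul, (hT.projection x).isSelfAdjoint.star_eq, StarMul.star_mul, star_star] at h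
  have hc : ∀ ρ : PathsTo x, Commute (T (𝟙 x)) (T ρ.2 * star (T ρ.2)) := fun ρ =>
    (hl ρ).trans (hr ρ).symm
  exact ((Commute.refl _).sub_right (hc ν)).sub_left
    ((hc μ).symm.sub_right (hT.range_commute hΛ μ.2 ν.2))

/-- A ⋆-homomorphism maps `gapProd` to `gapProd`. -/
theorem map_gapProd {A B : Type*} [NonUnitalCStarAlgebra A] [NonUnitalCStarAlgebra B]
    (π : A →⋆ₙₐ[ℂ] B) (T : PathFamily V A) {x : V} (E : Finset (PathsTo x)) :
    π (gapProd T E) = gapProd (fun _ _ μ => π (T μ)) E := by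
  unfold gapProd
  induction E.toList with
  | nil => rfl
  | cons e l ih => simp only [List.foldr_cons, map_mul, map_sub, map_star, ih]

/-- If the images of `s` under jointly injective ⋆-homomorphisms are relative Cuntz–Krieger
families, then so is `s`. -/
theorem isRelCKFamily_of_forall (hΛ : Λ.FinitelyAligned)
    {𝓔 : ∀ x : V, Set (Finset (PathsTo x))} {A : Type*} [NonUnitalCStarAlgebra A]
    {ι : Type*} {B : ι → Type*} [∀ i, NonUnitalCStarAlgebra (B i)] (π : ∀ i, A →⋆ₙₐ[ℂ] B i)
    (hπ : ∀ x y : A, (∀ i, π i x = π i y) → x = y) (s : PathFamily V A)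
    (h : ∀ i, Λ.IsRelCKFamily 𝓔 (fun _ _ μ => π i (s μ))) : Λ.IsRelCKFamily 𝓔 s where
  partialIsometry a b μ := hπ _ _ fun i => by
    simpa only [map_mul, map_star] using (h i).partialIsometry μ
  projection x := by
    refine ⟨hπ _ _ fun i => ?_, hπ _ _ fun i => ?_⟩
    · simpa only [map_mul] using ((h i).projection x).isIdempotentElem.eq
    · simpa only [map_star] using ((h i).projection x).isSelfAdjoint.star_eq
  orthogonal x y hxy := hπ _ _ fun i => by
    simpa only [map_mul, map_zero] using (h i).orthogonal x y hxy
  mul a b c μ ν := hπ _ _ fun i => by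
    simpa only [map_mul] using (h i).mul μ ν
  star_mul a b x μ ν := hπ _ _ fun i => by
    have h1 := (h i).star_mul μ ν
    rw [finsum_mem_eq_finite_toFinset_sum _ (hΛ μ ν)] at h1 ⊢
    simpa only [map_mul, map_star, map_sum] using h1
  star_mul_of_ne a b x y μ ν hxy := hπ _ _ fun i => by
    simpa only [map_mul, map_star, map_zero] using (h i).star_mul_of_ne μ ν hxy
  gapProd_eq_zero x E hE := hπ _ _ fun i => by
    rw [map_gapProd, map_zero]; exact (h i).gapProd_eq_zero x E hE

/-- The elements of a Toeplitz–Cuntz–Krieger family have norm at most `1`. -/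
theorem IsTCKFamily.norm_le_one {A : Type w} [NonUnitalCStarAlgebra A] {T : PathFamily V A}
    (hT : Λ.IsTCKFamily T) {a b : V} (μ : a ⟶ b) : ‖T μ‖ ≤ 1 := by
  by_contra! hlt
  have h1 : star (T μ) * T μ * (star (T μ) * T μ) = star (T μ) * T μ := by
    rw [mul_assoc, ← mul_assoc (T μ), hT.partialIsometry]
  have h2 : ‖star (T μ) * T μ‖ = ‖T μ‖ * ‖T μ‖ := CStarRing.norm_star_mul_self
  have h3 : ‖star (T μ) * T μ‖ * ‖star (T μ) * T μ‖ = ‖star (T μ) * T μ‖ := by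
    have h4 := CStarRing.norm_star_mul_self (x := star (T μ) * T μ)
    rw [StarMul.star_mul, star_star, h1] at h4
    exact h4.symm
  rw [h2] at h3
  have h5 : 1 < ‖T μ‖ * ‖T μ‖ := one_lt_mul_of_lt_of_le hlt hlt.le
  nlinarith

/-- Evaluation at an index, as a ⋆-homomorphism on a bounded product of C⋆-algebras. -/
noncomputable def lpEval {ι : Type*} (B : ι → Type*) [∀ i, NonUnitalCStarAlgebra (B i)] (i : ι) :
    lp B ⊤ →⋆ₙₐ[ℂ] B i where
  toFun f := f i
  map_smul' _ _ := rfl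
  map_zero' := rfl
  map_add' _ _ := rfl
  map_mul' f g := by rw [lp.infty_coeFn_mul]; rfl
  map_star' _ := rfl

/-- For every finitely aligned `k`-graph `Λ` and every `𝓔` there is a universal relative
Cuntz–Krieger `(Λ; 𝓔)`-family: the C⋆-algebra `C*(Λ; 𝓔)` exists. -/
theorem exists_isUniversalFamily (hΛ : Λ.FinitelyAligned)
    (𝓔 : ∀ x : V, Set (Finset (PathsTo x))) :
    ∃ (A : Type (max u v + 1)) (_ : NonUnitalCStarAlgebra A) (s : PathFamily V A),
      Λ.IsUniversalFamily 𝓔 s := by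
  let ι : Type (max u v + 1) := Σ' (B : Type (max u v)) (_ : NonUnitalCStarAlgebra B)
    (T : PathFamily V B), Λ.IsRelCKFamily 𝓔 T
  let B : ι → Type (max u v) := fun i => i.1
  let _ : ∀ i, NonUnitalCStarAlgebra (B i) := fun i => i.2.1
  let T : ∀ i, PathFamily V (B i) := fun i => i.2.2.1
  have hT : ∀ i, Λ.IsRelCKFamily 𝓔 (T i) := fun i => i.2.2.2
  let t : PathFamily V (lp B ⊤) := fun a b μ => ⟨fun i => T i μ, memℓp_infty
    ⟨1, by rintro _ ⟨i, rfl⟩; exact (hT i).toIsTCKFamily.norm_le_one μ⟩⟩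
  let gen : Set (lp B ⊤) := {y | ∃ (a b : V) (μ : a ⟶ b), y = t μ}
  let S : NonUnitalStarSubalgebra ℂ (lp B ⊤) :=
    (NonUnitalStarAlgebra.adjoin ℂ gen).topologicalClosure
  have hS : IsClosed (S : Set (lp B ⊤)) :=
    NonUnitalStarSubalgebra.isClosed_topologicalClosure _
  have hmem : ∀ {a b : V} (μ : a ⟶ b), t μ ∈ S := fun {a b} μ =>
    NonUnitalStarSubalgebra.le_topologicalClosure _
      (NonUnitalStarAlgebra.subset_adjoin ℂ gen ⟨a, b, μ, rfl⟩)
  let inst : NonUnitalCStarAlgebra S :=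
    NonUnitalStarSubalgebra.nonUnitalCStarAlgebra S (h_closed := hS)
  let s : PathFamily V S := fun a b μ => ⟨t μ, hmem μ⟩
  let π : ∀ i, S →⋆ₙₐ[ℂ] B i := fun i =>
    (lpEval B i).comp (NonUnitalStarSubalgebraClass.subtype S)
  refine ⟨S, inst, s, ?_, ?_, ?_⟩
  · refine isRelCKFamily_of_forall hΛ π (fun x y hxy => ?_) s (fun i => hT i)
    exact Subtype.ext (lp.ext (funext fun i => hxy i))
  · refine SetLike.coe_injective (Set.eq_univ_of_forall fun y => ?_)
    change y ∈ closure ((NonUnitalStarAlgebra.adjoin ℂ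
      {z : S | ∃ (a b : V) (μ : a ⟶ b), z = s μ} : NonUnitalStarSubalgebra ℂ S) : Set S)
    rw [closure_subtype]
    have hy : (y : lp B ⊤) ∈ closure (NonUnitalStarAlgebra.adjoin ℂ gen : Set (lp B ⊤)) := y.2
    refine closure_mono (fun z hz => ?_) hy
    have hle : NonUnitalStarAlgebra.adjoin ℂ gen ≤ NonUnitalStarSubalgebra.map
        (NonUnitalStarSubalgebraClass.subtype S) (NonUnitalStarAlgebra.adjoin ℂ
          {z : S | ∃ (a b : V) (μ : a ⟶ b), z = s μ}) := by
      refine NonUnitalStarAlgebra.adjoin_le ?_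
      rintro _ ⟨a, b, μ, rfl⟩
      exact ⟨s μ, NonUnitalStarAlgebra.subset_adjoin ℂ _ ⟨a, b, μ, rfl⟩, rfl⟩
    exact hle hz
  · intro C _ T' hT'
    exact ⟨π ⟨C, _, T', hT'⟩, fun a b μ => rfl⟩

end KGraph

/-! If `E` contains a member of `𝓔`, its gap product vanishes because the factors commute and a
subproduct is already zero. For the converse it suffices to find one relative Cuntz–Krieger family
in which the gap product of a given finite edge set `E` outside the satiation is non-zero.

That family acts on `ℓ²` of the space of boundary paths: filters of paths, under the prefix order,
whose tail at each of their members meets every set of `𝓔` there. Prepending `μ` is a partial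
bijection of this space, hence gives a partial isometry, and the gap product over `E` becomes the
projection onto the boundary paths at `x` that start with no edge of `E`. So a boundary path
avoiding `E` is needed.

The obstruction is `Blocked`. By (E2) being blocked passes to extensions (`blocked_append`), so a
member of `𝓔` blocks every path with its range. By (E3) a path that is not blocked by `E` extends,
inside any member of `𝓔` at its source, to one that is not blocked (`exists_not_blocked`). An edge
set outside the satiation does not block its vertex, and a generic filter of unblocked paths,
meeting countably many cofinal sets, is the boundary path (`exists_boundaryPath`). The first claim
is the case `E = ∅` of the second, as the empty set is not exhaustive. -/

namespace KGraph

variable {k : ℕ} {V : Type u} [Category.{v} V] (Λ : KGraph k V)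

/-! ### Prefixes and unique factorisation -/

/-- The path `μ` is a prefix of the path `ν`. -/
def IsPrefix {x : V} (μ ν : PathsTo x) : Prop := ∃ h : ν.1 ⟶ μ.1, h ≫ μ.2 = ν.2

/-- The concatenation `αg`. -/
abbrev append {x : V} (α : PathsTo x) (g : PathsTo α.1) : PathsTo x := ⟨g.1, g.2 ≫ α.2⟩

theorem IsPrefix.refl {x : V} (μ : PathsTo x) : IsPrefix μ μ := ⟨𝟙 _, Category.id_comp _⟩

theorem IsPrefix.trans {x : V} {μ ν ρ : PathsTo x} (h₁ : IsPrefix μ ν) (h₂ : IsPrefix ν ρ) :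
    IsPrefix μ ρ := by
  obtain ⟨f, hf⟩ := h₁
  obtain ⟨g, hg⟩ := h₂
  exact ⟨g ≫ f, by rw [Category.assoc, hf, hg]⟩

theorem isPrefix_append {x : V} (α : PathsTo x) (g : PathsTo α.1) : IsPrefix α (append α g) :=
  ⟨g.2, rfl⟩

theorem IsPrefix.append {x : V} {α : PathsTo x} {g h : PathsTo α.1} (hgh : IsPrefix g h) :
    IsPrefix (append α g) (append α h) := by
  obtain ⟨f, hf⟩ := hgh
  exact ⟨f, by simp only [← hf, Category.assoc]⟩

theorem id_isPrefix {x : V} (α : PathsTo x) : IsPrefix ⟨x, 𝟙 x⟩ α := ⟨α.2, Category.comp_id _⟩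

/-- The prefix preorder on the paths with a given range. -/
abbrev prefixPreorder (x : V) : Preorder (PathsTo x) where
  le := IsPrefix
  le_refl := IsPrefix.refl
  le_trans _ _ _ := IsPrefix.trans

theorem factor_unique {a b : V} (p q : Σ c : V, (c ⟶ b) × (a ⟶ c))
    (h : p.2.2 ≫ p.2.1 = q.2.2 ≫ q.2.1) (hd : Λ.d p.2.1 = Λ.d q.2.1) : p = q := by
  have h2 : Λ.d p.2.2 = Λ.d q.2.2 := by
    have h3 := congrArg (fun f => Λ.d f) h
    simp only [Λ.d_comp, hd] at h3
    exact add_left_cancel h3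
  exact (Λ.factor (q.2.2 ≫ q.2.1) _ _ (Λ.d_comp _ _)).unique ⟨h, hd, h2⟩ ⟨rfl, rfl, rfl⟩

theorem cancel_right (Λ : KGraph k V) {a b x : V} {f g : a ⟶ b} {μ : b ⟶ x} (h : f ≫ μ = g ≫ μ) : f = g := by
  have := Λ.factor_unique ⟨b, μ, f⟩ ⟨b, μ, g⟩ h rfl
  simpa using this

theorem IsPrefix.of_append (Λ : KGraph k V) {x : V} {α : PathsTo x} {g h : PathsTo α.1}
    (hgh : IsPrefix (KGraph.append α g) (KGraph.append α h)) : IsPrefix g h := by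
  obtain ⟨f, hf⟩ := hgh
  refine ⟨f, Λ.cancel_right (μ := α.2) ?_⟩
  simpa using hf

theorem IsPrefix.degree_le {x : V} {α β : PathsTo x} (h : IsPrefix α β) :
    Λ.d α.2 ≤ Λ.d β.2 := by
  obtain ⟨f, hf⟩ := h
  rw [← hf, Λ.d_comp]
  exact le_self_add

theorem exists_prefix {x : V} (β : PathsTo x) {m : Fin k → ℕ} (hm : m ≤ Λ.d β.2) :
    ∃ α : PathsTo x, IsPrefix α β ∧ Λ.d α.2 = m := by
  obtain ⟨p, ⟨hp, hd, -⟩, -⟩ := Λ.factor β.2 m (Λ.d β.2 - m) (add_tsub_cancel_of_le hm).symm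
  exact ⟨⟨p.1, p.2.1⟩, ⟨p.2.2, hp⟩, hd⟩

theorem isPrefix_unique {x : V} {α β γ : PathsTo x} (h₁ : IsPrefix α γ) (h₂ : IsPrefix β γ)
    (hd : Λ.d α.2 = Λ.d β.2) : α = β := by
  obtain ⟨f, hf⟩ := h₁
  obtain ⟨g, hg⟩ := h₂
  have h := Λ.factor_unique ⟨α.1, α.2, f⟩ ⟨β.1, β.2, g⟩ (hf.trans hg.symm) hd
  rw [Sigma.mk.injEq] at h
  obtain ⟨a, α⟩ := α
  obtain ⟨b, β⟩ := β
  obtain ⟨h1, h2⟩ := h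
  dsimp only at h1
  subst h1
  exact congrArg (Sigma.mk a) (Prod.mk.inj (eq_of_heq h2)).1

/-- Prefixes of one path are determined by their degrees, so they are ordered exactly as their
degrees are. -/
theorem IsPrefix.of_degree_le {x : V} {α β γ : PathsTo x} (h₁ : IsPrefix α γ)
    (h₂ : IsPrefix β γ) (hd : Λ.d α.2 ≤ Λ.d β.2) : IsPrefix α β := by
  obtain ⟨α', h, hα'⟩ := Λ.exists_prefix β hd
  rwa [Λ.isPrefix_unique h₁ (h.trans h₂) hα'.symm]

theorem eq_id_of_degree_eq_zero {x : V} {α : PathsTo x} (h : Λ.d α.2 = 0) : α = ⟨x, 𝟙 x⟩ :=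
  Λ.isPrefix_unique (IsPrefix.refl α) (id_isPrefix α) (h.trans (Λ.d_id x).symm)

/-- For an edge, the comparison of degrees reduces to the single coordinate `i`. -/
theorem IsEdge.isPrefix_of_one_le {x : V} {e β γ : PathsTo x} {i : Fin k}
    (he : Λ.d e.2 = Pi.single i 1) (h₁ : IsPrefix e γ) (h₂ : IsPrefix β γ)
    (hi : 1 ≤ Λ.d β.2 i) : IsPrefix e β := by
  refine IsPrefix.of_degree_le Λ h₁ h₂ ?_
  rw [he]
  intro j
  rcases eq_or_ne j i with rfl | hj
  · simpa using hi
  · simp [hj]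

theorem IsEdge.eq_of_isPrefix {x : V} {e f : PathsTo x} (he : Λ.IsEdge e.2) (hf : Λ.IsEdge f.2)
    (h : IsPrefix e f) : e = f := by
  obtain ⟨i, hi⟩ := he
  obtain ⟨j, hj⟩ := hf
  have h1 := IsPrefix.degree_le Λ h i
  rw [hi, hj] at h1
  have hij : i = j := by
    by_contra hne
    simp [hne] at h1
  exact Λ.isPrefix_unique h (IsPrefix.refl f) (by rw [hi, hj, hij])

/-! ### Blocked paths -/

/-- A path `α` is blocked by `E` if it has a prefix in `E`, or if all its extensions by the
elements of some member of `𝓔` at its source have a prefix in `E`. -/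
def Blocked (𝓔 : ∀ x : V, Set (Finset (PathsTo x))) {x : V} (E : Finset (PathsTo x))
    (α : PathsTo x) : Prop :=
  (∃ e ∈ E, IsPrefix e α) ∨ ∃ F ∈ 𝓔 α.1, ∀ g ∈ F, ∃ e ∈ E, IsPrefix e (append α g)

variable {Λ} {𝓔 : ∀ x : V, Set (Finset (PathsTo x))}

theorem blocked_id_of_mem {x : V} {E : Finset (PathsTo x)} (hE : E ∈ 𝓔 x) :
    Blocked 𝓔 E ⟨x, 𝟙 x⟩ :=
  Or.inr ⟨E, hE, fun g hg => ⟨g, hg, 𝟙 _, by simp⟩⟩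

/-- This is (E2): if `F` witnesses that `α` is blocked and `f ∉ F`, a member of `𝓔` inside `Ext(f;
F)` is a witness for `αf`, since each of its elements extends `αf` to an extension of some `αf'`
with `f' ∈ F`. -/
theorem IsEfficient.blocked_append_edge (h𝓔 : Λ.IsEfficient 𝓔) {x : V} {E : Finset (PathsTo x)}
    {α : PathsTo x} (h : Blocked 𝓔 E α) (f : PathsTo α.1) (hf : Λ.IsEdge f.2) :
    Blocked 𝓔 E (append α f) := by
  rcases h with ⟨e, he, h⟩ | ⟨F, hF, h⟩
  · exact Or.inl ⟨e, he, h.trans (isPrefix_append α f)⟩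
  by_cases hfF : f ∈ F
  · exact Or.inl (h f hfF)
  obtain ⟨G, hG, hGF⟩ := h𝓔.ext_mem _ F hF f hf hfF
  refine Or.inr ⟨G, hG, fun g hg => ?_⟩
  obtain ⟨f', hf', h', hmin, -⟩ := hGF hg
  obtain ⟨e, he, hef⟩ := h f' hf'
  refine ⟨e, he, hef.trans ⟨h', ?_⟩⟩
  have : g.2 ≫ f.2 = h' ≫ f'.2 := hmin
  simp only [← Category.assoc, this]

theorem IsEfficient.blocked_append (h𝓔 : Λ.IsEfficient 𝓔) {x : V} {E : Finset (PathsTo x)}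
    {α : PathsTo x} (h : Blocked 𝓔 E α) (β : PathsTo α.1) : Blocked 𝓔 E (append α β) := by
  obtain ⟨n, hn⟩ : ∃ n, n = ∑ i, Λ.d β.2 i := ⟨_, rfl⟩
  induction n generalizing α with
  | zero =>
    have h0 : Λ.d β.2 = 0 := by
      funext i
      simpa using (Finset.sum_eq_zero_iff.1 hn.symm) i (Finset.mem_univ i)
    have h1 := Λ.eq_id_of_degree_eq_zero h0
    subst h1
    simpa [append] using h
  | succ n ih =>
    obtain ⟨i, -, hi⟩ : ∃ i ∈ Finset.univ, Λ.d β.2 i ≠ 0 := by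
      by_contra! hcon
      rw [Finset.sum_eq_zero hcon] at hn
      omega
    have hle : Pi.single i 1 ≤ Λ.d β.2 := by
      intro j
      rcases eq_or_ne j i with rfl | hj
      · simpa using Nat.one_le_iff_ne_zero.2 hi
      · simp [hj]
    obtain ⟨f, ⟨g, hg⟩, hd⟩ := Λ.exists_prefix β hle
    have hb := ih (h𝓔.blocked_append_edge h f ⟨i, hd⟩) ⟨β.1, g⟩ (by
      rw [← hg] at hn
      simp only [Λ.d_comp, hd, Pi.add_apply, Finset.sum_add_distrib, Finset.sum_pi_single',
        Finset.mem_univ, if_true] at hn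
      dsimp only at hn ⊢
      omega)
    have he : append (append α f) ⟨β.1, g⟩ = append α β := by
      simp only [append, ← hg, Category.assoc]
    rwa [he] at hb

/-- The form in which (E2) is used below: a path that has not yet entered `E` is sure to do so after
one more step through a suitable member of `𝓔`. -/
theorem IsEfficient.blocked_of_mem (h𝓔 : Λ.IsEfficient 𝓔) {x : V} {E : Finset (PathsTo x)}
    (hE : E ∈ 𝓔 x) (α : PathsTo x) : Blocked 𝓔 E α := by
  simpa [append] using h𝓔.blocked_append (blocked_id_of_mem hE) α

/-- A path that is not blocked can be extended by an element of any member of `𝓔`. -/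
theorem IsEfficient.exists_not_blocked (h𝓔 : Λ.IsEfficient 𝓔) {x : V} {E : Finset (PathsTo x)}
    (hE : ∀ e ∈ E, Λ.IsEdge e.2) {α : PathsTo x} (hα : ¬ Blocked 𝓔 E α)
    {F : Finset (PathsTo α.1)} (hF : F ∈ 𝓔 α.1) : ∃ f ∈ F, ¬ Blocked 𝓔 E (append α f) := by
  classical
  by_contra! hcon
  -- Descent on the number of `f ∈ F` for which `αf` has no prefix in `E`; at zero, `F` itself shows
  -- that `α` is blocked.
  obtain ⟨n, hn⟩ : ∃ n, n = (F.filter fun f => ¬ ∃ e ∈ E, IsPrefix e (append α f)).card :=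
    ⟨_, rfl⟩
  induction n using Nat.strong_induction_on generalizing F with
  | _ n ih =>
    by_cases hall : ∀ f ∈ F, ∃ e ∈ E, IsPrefix e (append α f)
    · exact hα (Or.inr ⟨F, hF, hall⟩)
    push Not at hall
    obtain ⟨f, hfF, hf⟩ := hall
    obtain ⟨G, hG, hGE⟩ := (hcon f hfF).resolve_left fun ⟨e, he, h⟩ => hf e he h
    obtain ⟨F', hF', hsub⟩ := h𝓔.push_mem _ F hF f hfF G hG
    -- The edge `e` below `αfg` is not below `αf`, so `αf` has degree zero in the direction `i` of
    -- `e` and this direction comes from `g`. The path `h` has the degree of `g`, so `αh` already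
    -- contains `e`.
    have key : ∀ h ∈ Λ.pushFront f.2 (G : Set (PathsTo f.1)),
        ∃ e ∈ E, IsPrefix e (append α h) := by
      rintro h ⟨g, hg, hd, t, ht⟩
      obtain ⟨e, he, hpe⟩ := hGE g hg
      obtain ⟨i, hi⟩ := hE e he
      refine ⟨e, he, IsEdge.isPrefix_of_one_le Λ hi hpe ⟨t, ?_⟩ ?_⟩
      · simp only [append, ← Category.assoc, ht]
      · have h0 : Λ.d (append α f).2 i = 0 := by
          by_contra hne
          exact hf e he (IsEdge.isPrefix_of_one_le Λ hi hpe (isPrefix_append _ _)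
            (Nat.one_le_iff_ne_zero.2 hne))
        have h1 := IsPrefix.degree_le Λ hpe i
        rw [hi] at h1
        simp only [append, Λ.d_comp, Pi.add_apply, Pi.single_eq_same, hd] at h0 h1 ⊢
        omega
    -- By `key` the elements of `F'` without a prefix in `E` all lie in `F \ {f}`, so the count
    -- drops.
    refine ih _ ?_ hF' (fun h hh => ?_) rfl
    · rw [hn]
      refine Finset.card_lt_card ⟨fun h hh => ?_, fun hle => ?_⟩
      · rw [Finset.mem_filter] at hh ⊢
        rcases hsub hh.1 with h1 | h1
        · exact ⟨h1.1, hh.2⟩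
        · exact absurd (key h h1) hh.2
      · have hm := hle (Finset.mem_filter.2 ⟨hfF, by push Not; exact hf⟩)
        rw [Finset.mem_filter] at hm
        rcases hsub hm.1 with h1 | h1
        · exact h1.2 rfl
        · exact hm.2 (key f h1)
    · rcases hsub hh with h1 | h1
      · exact hcon h h1.1
      · exact Or.inl (key h h1)

/-- An edge that is a prefix of an edge equals it, so a member of `𝓔` witnessing that the vertex is
blocked is a subset of `E`; exhaustiveness passes from it to `E`. -/
theorem IsEfficient.not_blocked_id (h𝓔 : Λ.IsEfficient 𝓔) {x : V} {E : Finset (PathsTo x)}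
    (hE : ∀ e ∈ E, Λ.IsEdge e.2) (h : E ∉ Λ.edgeSatiation 𝓔 x) : ¬ Blocked 𝓔 E ⟨x, 𝟙 x⟩ := by
  rintro (⟨e, he, hp⟩ | ⟨F, hF, hFE⟩)
  · obtain ⟨i, hi⟩ := hE e he
    have h1 := IsPrefix.degree_le Λ hp i
    simp [hi, Λ.d_id] at h1
  · have hFe := (h𝓔.subset_edgeFE x hF)
    have hsub : F ⊆ E := by
      intro g hg
      obtain ⟨e, he, hp⟩ := hFE g hg
      have hp' : IsPrefix e g := by simpa [append] using hp
      rwa [← IsEdge.eq_of_isPrefix Λ (hE e he) (hFe.2 g hg) hp']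
    refine h ⟨⟨⟨fun hid => ?_, fun μ => ?_⟩, hE⟩, F, hF, hsub⟩
    · obtain ⟨i, hi⟩ := hE _ hid
      have := congrFun hi i
      simp [Λ.d_id] at this
    · obtain ⟨ν, hν, hne⟩ := hFe.1.2 μ
      exact ⟨ν, hsub hν, hne⟩

/-! ### Boundary paths and their existence -/

/-- An `𝓔`-boundary path with range `x`, given as the set `U` of its finite prefixes: a filter of
paths such that the tail of `U` at each vertex meets each member of `𝓔` at that vertex. -/
structure IsBoundaryPath (𝓔 : ∀ x : V, Set (Finset (PathsTo x))) {x : V}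
    (U : Set (PathsTo x)) : Prop where
  id_mem : ⟨x, 𝟙 x⟩ ∈ U
  lower : ∀ {μ ν}, IsPrefix μ ν → ν ∈ U → μ ∈ U
  directed : ∀ {μ ν}, μ ∈ U → ν ∈ U → ∃ ρ ∈ U, IsPrefix μ ρ ∧ IsPrefix ν ρ
  meets : ∀ μ ∈ U, ∀ F ∈ 𝓔 μ.1, ∃ e ∈ F, append μ e ∈ U

theorem IsEfficient.exists_boundaryPath (h𝓔 : Λ.IsEfficient 𝓔) {x : V} {E : Finset (PathsTo x)}
    (hE : ∀ e ∈ E, Λ.IsEdge e.2) (h : E ∉ Λ.edgeSatiation 𝓔 x) :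
    ∃ U : Set (PathsTo x), IsBoundaryPath 𝓔 U ∧ ∀ e ∈ E, e ∉ U := by
  let _ : Preorder (PathsTo x) := prefixPreorder x
  let P := {α : PathsTo x // ¬ Blocked 𝓔 E α}
  have : ∀ y : V, Countable (PathsTo y) := by
    intro y
    have := Λ.countable
    refine Function.Injective.countable
      (f := fun α : PathsTo y => (⟨α.1, y, α.2⟩ : Σ a b : V, (a ⟶ b))) ?_
    rintro ⟨a, α⟩ ⟨b, β⟩ hab
    simp only [Sigma.mk.injEq] at hab
    obtain ⟨rfl, hab⟩ := hab
    simpa using hab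
  let ι := Σ μ : PathsTo x, {F : Finset (PathsTo μ.1) // F ∈ 𝓔 μ.1}
  let _ : Encodable ι := Encodable.ofCountable ι
  -- For each requirement `(μ, F)`: either `β` already extends some `μe` with `e ∈ F`, or no
  -- unblocked extension of `β` passes through `μ`, so that the requirement is void.
  let D : ι → Order.Cofinal P := fun i =>
    { carrier := {β | (∃ e ∈ i.2.1, IsPrefix (append i.1 e) β.1) ∨
        ∀ γ : P, β ≤ γ → ¬ IsPrefix i.1 γ.1}
      isCofinal := by
        intro α
        by_cases hex : ∃ γ : P, α ≤ γ ∧ IsPrefix i.1 γ.1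
        · obtain ⟨⟨γ, hγ⟩, hαγ, t, ht⟩ := hex
          -- Here `F` blocks the tail `t` of `γ` after `μ`. If `t` has not entered `F`, an unblocked
          -- extension of `γ` by an element of `G` has.
          rcases h𝓔.blocked_of_mem i.2.2 ⟨γ.1, t⟩ with ⟨e, he, hp⟩ | ⟨G, hG, hGF⟩
          · refine ⟨⟨γ, hγ⟩, Or.inl ⟨e, he, ?_⟩, hαγ⟩
            have := hp.append (α := i.1)
            simp only [append, ht] at this
            exact this
          · obtain ⟨g, hg, hb⟩ := h𝓔.exists_not_blocked hE hγ hG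
            obtain ⟨e, he, hp⟩ := hGF g hg
            refine ⟨⟨append γ g, hb⟩, Or.inl ⟨e, he, ?_⟩,
              IsPrefix.trans hαγ (isPrefix_append γ g)⟩
            have := hp.append (α := i.1)
            simp only [append, Category.assoc, ht] at this
            exact this
        · push Not at hex
          exact ⟨α, Or.inr hex, le_refl α⟩ }
  let I := Order.idealOfCofinals (⟨⟨x, 𝟙 x⟩, h𝓔.not_blocked_id hE h⟩ : P) D
  refine ⟨{α | ∃ β ∈ I, IsPrefix α β.1}, ⟨?_, ?_, ?_, ?_⟩, ?_⟩
  · exact ⟨_, Order.mem_idealOfCofinals _ D, IsPrefix.refl _⟩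
  · rintro μ ν hμν ⟨β, hβ, hp⟩
    exact ⟨β, hβ, hμν.trans hp⟩
  · rintro μ ν ⟨β, hβ, hp⟩ ⟨γ, hγ, hq⟩
    obtain ⟨δ, hδ, h1, h2⟩ := I.directed β hβ γ hγ
    exact ⟨δ.1, ⟨δ, hδ, IsPrefix.refl _⟩, hp.trans h1, hq.trans h2⟩
  · rintro μ ⟨β, hβ, hp⟩ F hF
    obtain ⟨γ, hγD, hγ⟩ := Order.cofinal_meets_idealOfCofinals
      (⟨⟨x, 𝟙 x⟩, h𝓔.not_blocked_id hE h⟩ : P) D ⟨μ, F, hF⟩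
    rcases hγD with ⟨e, he, h1⟩ | h1
    · exact ⟨e, he, γ, hγ, h1⟩
    -- The requirement is not void: an upper bound of `β` and `γ` in the ideal is unblocked and
    -- extends `μ`.
    · obtain ⟨δ, hδ, h2, h3⟩ := I.directed β hβ γ hγ
      exact absurd (hp.trans h2) (h1 δ h3)
  · rintro e he ⟨β, -, hp⟩
    exact β.2 (Or.inl ⟨e, he, hp⟩)

/-! ### Prepending and removing an initial path -/

/-- The boundary path `μU`. -/
def prepend {a x : V} (μ : a ⟶ x) (U : Set (PathsTo a)) : Set (PathsTo x) :=
  {ν | ∃ α ∈ U, IsPrefix ν ⟨α.1, α.2 ≫ μ⟩}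

/-- The boundary path `U` with its prefix `μ` removed. -/
def shift {a x : V} (μ : a ⟶ x) (U : Set (PathsTo x)) : Set (PathsTo a) :=
  {α | ⟨α.1, α.2 ≫ μ⟩ ∈ U}

theorem IsEfficient.isBoundaryPath_prepend (h𝓔 : Λ.IsEfficient 𝓔) {a x : V} (μ : a ⟶ x)
    {U : Set (PathsTo a)} (hU : IsBoundaryPath 𝓔 U) : IsBoundaryPath 𝓔 (prepend μ U) where
  id_mem := ⟨_, hU.id_mem, id_isPrefix _⟩
  lower := by
    rintro α β hαβ ⟨γ, hγ, hp⟩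
    exact ⟨γ, hγ, hαβ.trans hp⟩
  directed := by
    rintro α β ⟨γ, hγ, hp⟩ ⟨δ, hδ, hq⟩
    obtain ⟨ε, hε, h1, h2⟩ := hU.directed hγ hδ
    exact ⟨append ⟨a, μ⟩ ε, ⟨ε, hε, IsPrefix.refl _⟩, hp.trans (h1.append (α := ⟨a, μ⟩)),
      hq.trans (h2.append (α := ⟨a, μ⟩))⟩
  meets := by
    rintro β ⟨α, hα, t, ht⟩ F hF
    -- The prefix `β` need not extend `μ`, so the condition at `F` is moved along `t` to a member
    -- `G` of `𝓔` at a vertex of `U`.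
    rcases h𝓔.blocked_of_mem hF ⟨α.1, t⟩ with ⟨e, he, hp⟩ | ⟨G, hG, hGF⟩
    · refine ⟨e, he, α, hα, ?_⟩
      have := hp.append (α := β)
      simp only [append, ht] at this
      exact this
    · obtain ⟨g, hg, hgU⟩ := hU.meets α hα G hG
      obtain ⟨e, he, hp⟩ := hGF g hg
      refine ⟨e, he, _, hgU, ?_⟩
      have := hp.append (α := β)
      simp only [append, Category.assoc, ht] at this
      simpa using this

theorem isBoundaryPath_shift (Λ : KGraph k V) {a x : V} {μ : a ⟶ x} {U : Set (PathsTo x)}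
    (hU : IsBoundaryPath 𝓔 U) (hμ : ⟨a, μ⟩ ∈ U) : IsBoundaryPath 𝓔 (shift μ U) where
  id_mem := by simpa [shift] using hμ
  lower := fun h hν => hU.lower (h.append (α := ⟨a, μ⟩)) hν
  directed := by
    rintro α β hα hβ
    obtain ⟨γ, hγ, h1, h2⟩ := hU.directed hα hβ
    obtain ⟨t, ht⟩ := (isPrefix_append ⟨a, μ⟩ α).trans h1
    have hγ' : γ = append ⟨a, μ⟩ ⟨γ.1, t⟩ := by simp only [append, ht]
    rw [hγ'] at h1 h2 hγ
    exact ⟨⟨γ.1, t⟩, hγ, IsPrefix.of_append Λ h1, IsPrefix.of_append Λ h2⟩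
  meets := by
    intro α hα F hF
    obtain ⟨e, he, h⟩ := hU.meets _ hα F hF
    exact ⟨e, he, by simpa [shift] using h⟩

theorem shift_prepend (Λ : KGraph k V) {a x : V} (μ : a ⟶ x) {U : Set (PathsTo a)}
    (hU : IsBoundaryPath 𝓔 U) : shift μ (prepend μ U) = U := by
  ext α
  refine ⟨fun ⟨β, hβ, hp⟩ => hU.lower (IsPrefix.of_append (α := ⟨_, μ⟩) Λ hp) hβ,
    fun h => ⟨α, h, IsPrefix.refl _⟩⟩

theorem prepend_shift {a x : V} {μ : a ⟶ x} {U : Set (PathsTo x)}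
    (hU : IsBoundaryPath 𝓔 U) (hμ : ⟨a, μ⟩ ∈ U) : prepend μ (shift μ U) = U := by
  ext α
  refine ⟨fun ⟨β, hβ, hp⟩ => hU.lower hp hβ, fun h => ?_⟩
  obtain ⟨γ, hγ, h1, t, ht⟩ := hU.directed h hμ
  exact ⟨⟨γ.1, t⟩, by simpa only [shift, Set.mem_ofPred_eq, ht] using hγ,
    by simpa only [ht] using h1⟩

theorem prepend_comp {a b x : V} (μ : b ⟶ x) (ν : a ⟶ b) (U : Set (PathsTo a)) :
    prepend μ (prepend ν U) = prepend (ν ≫ μ) U := by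
  ext α
  constructor
  · rintro ⟨β, ⟨γ, hγ, h1⟩, h2⟩
    exact ⟨γ, hγ, h2.trans (by simpa [append] using h1.append (α := ⟨b, μ⟩))⟩
  · rintro ⟨γ, hγ, h⟩
    exact ⟨⟨γ.1, γ.2 ≫ ν⟩, ⟨γ, hγ, IsPrefix.refl _⟩, by simpa using h⟩

theorem prepend_id {x : V} {U : Set (PathsTo x)} (hU : IsBoundaryPath 𝓔 U) :
    prepend (𝟙 x) U = U := by
  ext α
  exact ⟨fun ⟨β, hβ, hp⟩ => hU.lower (by simpa using hp) hβ,
    fun h => ⟨α, h, by simpa using IsPrefix.refl α⟩⟩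

theorem mem_prepend_self {a x : V} (μ : a ⟶ x) {U : Set (PathsTo a)}
    (hU : IsBoundaryPath 𝓔 U) : ⟨a, μ⟩ ∈ prepend μ U :=
  ⟨_, hU.id_mem, by simpa using IsPrefix.refl _⟩

end KGraph

/-! ### Partial isometries of `ℓ²` from partial bijections -/

namespace PEquiv

variable {X : Type u}

/-- The partial bijection with a given graph. -/
noncomputable def ofRel (R : X → X → Prop) (h₁ : ∀ p q q', R p q → R p q' → q = q')
    (h₂ : ∀ p p' q, R p q → R p' q → p = p') : X ≃. X := by
  classical
  exact
  { toFun := fun p => if h : ∃ q, R p q then some h.choose else none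
    invFun := fun q => if h : ∃ p, R p q then some h.choose else none
    inv := by
      intro p q
      simp only [Option.dite_none_right_eq_some, Option.some.injEq]
      constructor
      · rintro ⟨h, rfl⟩
        exact ⟨⟨q, h.choose_spec⟩, h₁ _ _ _ (Exists.choose_spec (p := R h.choose) _)
          h.choose_spec⟩
      · rintro ⟨h, rfl⟩
        exact ⟨⟨p, h.choose_spec⟩, h₂ _ _ _
          (Exists.choose_spec (p := fun p' => R p' h.choose) _) h.choose_spec⟩ }

theorem mem_ofRel {R : X → X → Prop} {h₁ : ∀ p q q', R p q → R p q' → q = q'}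
    {h₂ : ∀ p p' q, R p q → R p' q → p = p'} {p q : X} : q ∈ ofRel R h₁ h₂ p ↔ R p q := by
  classical
  simp only [ofRel, PEquiv.coe_mk, Option.mem_def, Option.dite_none_right_eq_some,
    Option.some.injEq]
  exact ⟨fun ⟨h, hq⟩ => hq ▸ h.choose_spec, fun h => ⟨⟨q, h⟩, h₁ _ _ _ (Exists.choose_spec _) h⟩⟩

theorem ext_mem {f g : X ≃. X} (h : ∀ p q, q ∈ f p ↔ q ∈ g p) : f = g :=
  PEquiv.ext fun p => Option.ext fun q => h p q

/-- The function obtained by transporting `φ` along `f`, extended by zero. -/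
def transport {M : Type*} [Zero M] (f : X ≃. X) (φ : X → M) (q : X) : M :=
  (f.symm q).elim 0 φ

theorem transport_of_mem {M : Type*} [Zero M] {f : X ≃. X} {φ : X → M} {p q : X} (h : q ∈ f p) :
    f.transport φ q = φ p := by
  have : f.symm q = some p := f.mem_iff_mem.2 h
  simp [transport, this]

theorem transport_of_forall_notMem {M : Type*} [Zero M] {f : X ≃. X} {φ : X → M} {q : X}
    (h : ∀ p, q ∉ f p) : f.transport φ q = 0 := by
  have : f.symm q = none := by
    rw [Option.eq_none_iff_forall_not_mem]
    exact fun p hp => h p (f.mem_iff_mem.1 hp)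
  simp [transport, this]

/-- Off the range of `f` the transported function is zero, and on it the function is an injective
reindexing of part of `φ`. Applied to `‖ξ‖²`, this makes `toOp` a well-defined contraction. -/
theorem transport_summable_and_tsum_le (f : X ≃. X) {φ : X → ℝ} (h0 : ∀ p, 0 ≤ φ p)
    (hφ : Summable φ) : Summable (f.transport φ) ∧ ∑' q, f.transport φ q ≤ ∑' p, φ p := by
  let i : {q // (f.symm q).isSome} → X := fun q => (f.symm q.1).get q.2
  have hi : ∀ q, f.symm q.1 = some (i q) := fun q => (Option.some_get q.2).symm
  have hinj : Function.Injective i := fun q q' h =>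
    Subtype.ext (f.symm.inj (hi q) ((hi q').trans (congrArg some h.symm)))
  have hcomp : f.transport φ ∘ Subtype.val = φ ∘ i := by
    funext q
    exact transport_of_mem (f.mem_iff_mem.1 (hi q))
  have hz : ∀ q ∉ Set.range (Subtype.val : {q // (f.symm q).isSome} → X),
      f.transport φ q = 0 := by
    intro q hq
    refine transport_of_forall_notMem fun p hp => hq ⟨⟨q, ?_⟩, rfl⟩
    rw [f.mem_iff_mem.2 hp]
    rfl
  refine ⟨(Subtype.val_injective.summable_iff hz).1 ?_, ?_⟩
  · rw [hcomp]
    exact hφ.comp_injective hinj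
  · rw [← Subtype.val_injective.tsum_eq
      (fun q hq => by_contra fun h => hq (hz q h) : Function.support (f.transport φ) ⊆ _)]
    exact (congrArg tsum hcomp).trans_le (tsum_comp_le_tsum_of_inj hφ h0 hinj)

theorem norm_transport (f : X ≃. X) (φ : X → ℂ) (q : X) :
    ‖f.transport φ q‖ ^ 2 = f.transport (fun p => ‖φ p‖ ^ 2) q := by
  unfold transport
  cases f.symm q <;> simp

/-- The Hilbert space of square summable functions. -/
abbrev L2 (X : Type u) : Type u := lp (fun _ : X => ℂ) 2

theorem summable_sq (ξ : L2 X) : Summable fun p => ‖ξ p‖ ^ 2 := by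
  simpa using (lp.memℓp ξ).summable (by simp)

theorem norm_sq_eq_tsum (ξ : L2 X) : ‖ξ‖ ^ 2 = ∑' p, ‖ξ p‖ ^ 2 := by
  simpa using lp.norm_rpow_eq_tsum (p := 2) (by simp) ξ

theorem memℓp_transport (f : X ≃. X) (ξ : L2 X) : Memℓp (f.transport ξ) 2 := by
  refine memℓp_gen ?_
  have := (f.transport_summable_and_tsum_le (fun p => sq_nonneg ‖ξ p‖) (summable_sq ξ)).1
  simpa only [ENNReal.toReal_ofNat, Real.rpow_ofNat, norm_transport] using this

/-- The partial isometry of `ℓ²(X)` given by a partial bijection of `X`. -/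
noncomputable def toOp (f : X ≃. X) : L2 X →L[ℂ] L2 X :=
  LinearMap.mkContinuous
    { toFun := fun ξ => ⟨f.transport ξ, f.memℓp_transport ξ⟩
      map_add' := fun ξ η => by
        ext q
        change f.transport (ξ + η : L2 X) q = f.transport ξ q + f.transport η q
        unfold transport
        cases f.symm q
        · exact (add_zero 0).symm
        · rfl
      map_smul' := fun c ξ => by
        ext q
        change f.transport (c • ξ : L2 X) q = c • f.transport ξ q
        unfold transport
        cases f.symm q <;> simp } 1 (by
    intro ξ
    rw [one_mul]
    refine (sq_le_sq₀ (norm_nonneg _) (norm_nonneg _)).1 ?_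
    rw [norm_sq_eq_tsum, norm_sq_eq_tsum]
    change ∑' q, ‖f.transport ξ q‖ ^ 2 ≤ _
    simp only [norm_transport]
    exact (f.transport_summable_and_tsum_le (fun p => sq_nonneg ‖ξ p‖) (summable_sq ξ)).2)

theorem toOp_apply (f : X ≃. X) (ξ : L2 X) (q : X) : f.toOp ξ q = f.transport ξ q := rfl

theorem toOp_mul (f g : X ≃. X) : g.toOp * f.toOp = (f.trans g).toOp := by
  ext ξ q
  change g.transport (f.transport ξ) q = (f.trans g).transport ξ q
  unfold transport
  rw [PEquiv.symm_trans_rev]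
  change _ = ((g.symm q).bind f.symm).elim 0 _
  cases g.symm q <;> rfl

/-- Both inner products are sums over the graph of `f`, indexed once by its sources and once by its
targets. -/
theorem star_toOp (f : X ≃. X) : star f.toOp = f.symm.toOp := by
  symm
  rw [ContinuousLinearMap.star_eq_adjoint, ContinuousLinearMap.eq_adjoint_iff]
  intro ξ η
  rw [lp.inner_eq_tsum, lp.inner_eq_tsum]
  have hmem : ∀ q : Function.support (fun q => inner ℂ (ξ q) (f.toOp η q)), ∃ p, q.1 ∈ f p := by
    intro q
    by_contra! h
    exact q.2 (by simp only [toOp_apply, transport_of_forall_notMem h, inner_zero_right])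
  choose i hi using hmem
  refine tsum_eq_tsum_of_ne_zero_bij i (fun q q' h => ?_) (fun p hp => ?_) (fun q => ?_)
  · have h1 := hi q
    rw [h] at h1
    exact Subtype.ext (Option.mem_unique h1 (hi q'))
  · have hp' : ∃ q, q ∈ f p := by
      by_contra! h
      refine hp ?_
      simp only [toOp_apply]
      rw [transport_of_forall_notMem, inner_zero_left]
      exact fun q hq => h q (f.mem_iff_mem.1 hq)
    obtain ⟨q, hq⟩ := hp'
    have hs : q ∈ Function.support (fun q => inner ℂ (ξ q) (f.toOp η q)) := by
      simp only [Function.mem_support, toOp_apply, transport_of_mem hq] at hp ⊢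
      rwa [transport_of_mem (f.mem_iff_mem.2 hq)] at hp
    exact ⟨⟨q, hs⟩, f.inj (hi ⟨q, hs⟩) hq⟩
  · simp only [toOp_apply]
    rw [transport_of_mem (f.mem_iff_mem.2 (hi q)), transport_of_mem (hi q)]

/-- Disjoint ranges suffice: the value at `q` involves only the graph points with target `q`, so at
most one summand is non-zero there. -/
theorem toOp_eq_sum {ι : Type*} {s : Finset ι} {f : X ≃. X} {g : ι → X ≃. X}
    (h : ∀ p q, q ∈ f p ↔ ∃ i ∈ s, q ∈ g i p)
    (hdisj : ∀ i ∈ s, ∀ j ∈ s, ∀ p p' q, q ∈ g i p → q ∈ g j p' → i = j) :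
    f.toOp = ∑ i ∈ s, (g i).toOp := by
  ext ξ q
  rw [sum_apply, lp.coeFn_sum, Finset.sum_apply]
  simp only [toOp_apply]
  by_cases hq : ∃ p, q ∈ f p
  · obtain ⟨p, hp⟩ := hq
    obtain ⟨i, hi, hip⟩ := (h p q).1 hp
    rw [Finset.sum_eq_single_of_mem i hi, transport_of_mem hp, transport_of_mem hip]
    intro j hj hji
    exact transport_of_forall_notMem fun p' hp' => hji (hdisj j hj i hi _ _ _ hp' hip)
  · push Not at hq
    rw [transport_of_forall_notMem hq, Finset.sum_eq_zero]
    exact fun i hi => transport_of_forall_notMem fun p hp => hq p ((h p q).2 ⟨i, hi, hp⟩)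

end PEquiv

/-! ### The boundary path representation and its gap products -/

namespace KGraph

variable {k : ℕ} {V : Type u} [Category.{v} V] {Λ : KGraph k V}
  {𝓔 : ∀ x : V, Set (Finset (PathsTo x))}

/-- The space of all `𝓔`-boundary paths. -/
abbrev BoundarySpace (𝓔 : ∀ x : V, Set (Finset (PathsTo x))) : Type (max u v) :=
  Σ x : V, {U : Set (PathsTo x) // IsBoundaryPath 𝓔 U}

/-- The relation `q = μp` between boundary paths. -/
def Prepends {a b : V} (μ : a ⟶ b) (p q : BoundarySpace 𝓔) : Prop :=
  ∃ (U : {U : Set (PathsTo a) // IsBoundaryPath 𝓔 U})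
    (W : {U : Set (PathsTo b) // IsBoundaryPath 𝓔 U}),
    p = ⟨a, U⟩ ∧ q = ⟨b, W⟩ ∧ W.1 = prepend μ U.1

/-- The boundary path `q` has range `x` and starts with `μ`. -/
def StartsWith {x : V} (q : BoundarySpace 𝓔) (μ : PathsTo x) : Prop :=
  ∃ W, q = ⟨x, W⟩ ∧ μ ∈ W.1

theorem prepends_mk {a b : V} {μ : a ⟶ b} {U : {U : Set (PathsTo a) // IsBoundaryPath 𝓔 U}}
    {q : BoundarySpace 𝓔} : Prepends μ ⟨a, U⟩ q ↔ ∃ W, q = ⟨b, W⟩ ∧ W.1 = prepend μ U.1 := by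
  constructor
  · rintro ⟨U', W, hU, hq, hW⟩
    obtain rfl := eq_of_heq (Sigma.mk.inj hU).2
    exact ⟨W, hq, hW⟩
  · rintro ⟨W, hq, hW⟩
    exact ⟨U, W, rfl, hq, hW⟩

theorem prepends_mk_mk {a b : V} {μ : a ⟶ b} {U : {U : Set (PathsTo a) // IsBoundaryPath 𝓔 U}}
    {W : {U : Set (PathsTo b) // IsBoundaryPath 𝓔 U}} :
    Prepends μ ⟨a, U⟩ ⟨b, W⟩ ↔ W.1 = prepend μ U.1 := by
  rw [prepends_mk]
  constructor
  · rintro ⟨W', hW, h⟩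
    obtain rfl := eq_of_heq (Sigma.mk.inj hW).2
    exact h
  · exact fun h => ⟨W, rfl, h⟩

theorem startsWith_mk {x : V} {μ : PathsTo x} {W : {U : Set (PathsTo x) // IsBoundaryPath 𝓔 U}} :
    StartsWith ⟨x, W⟩ μ ↔ μ ∈ W.1 := by
  constructor
  · rintro ⟨W', hW, h⟩
    obtain rfl := eq_of_heq (Sigma.mk.inj hW).2
    exact h
  · exact fun h => ⟨W, rfl, h⟩

theorem Prepends.right_unique {a b : V} {μ : a ⟶ b} {p q q' : BoundarySpace 𝓔}
    (h : Prepends μ p q) (h' : Prepends μ p q') : q = q' := by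
  obtain ⟨U, W, rfl, rfl, hW⟩ := h
  obtain ⟨W', rfl, hW'⟩ := prepends_mk.1 h'
  rw [Subtype.ext (hW.trans hW'.symm)]

theorem Prepends.left_unique (Λ : KGraph k V) {a b : V} {μ : a ⟶ b} {p p' q : BoundarySpace 𝓔}
    (h : Prepends μ p q) (h' : Prepends μ p' q) : p = p' := by
  obtain ⟨U, W, rfl, rfl, hW⟩ := h
  obtain ⟨U', W', rfl, hq, hW'⟩ := h'
  obtain rfl := eq_of_heq (Sigma.mk.inj hq).2
  have h1 := congrArg (shift μ) (hW.symm.trans hW')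
  rw [shift_prepend Λ μ U.2, shift_prepend Λ μ U'.2] at h1
  rw [Subtype.ext h1]

theorem prepends_id {x : V} {p q : BoundarySpace 𝓔} :
    Prepends (𝟙 x) p q ↔ p = q ∧ q.1 = x := by
  constructor
  · rintro ⟨U, W, rfl, rfl, h⟩
    rw [prepend_id U.2] at h
    rw [Subtype.ext h]
    exact ⟨rfl, rfl⟩
  · rintro ⟨rfl, rfl⟩
    obtain ⟨x, U⟩ := p
    exact prepends_mk_mk.2 (prepend_id U.2).symm

theorem IsEfficient.prepends_comp (h𝓔 : Λ.IsEfficient 𝓔) {a b c : V} (μ : b ⟶ c) (ν : a ⟶ b)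
    {p q : BoundarySpace 𝓔} :
    (∃ r, Prepends ν p r ∧ Prepends μ r q) ↔ Prepends (ν ≫ μ) p q := by
  constructor
  · rintro ⟨r, ⟨U, W, rfl, rfl, h⟩, h'⟩
    obtain ⟨Z, rfl, hZ⟩ := prepends_mk.1 h'
    rw [prepends_mk_mk, hZ, h, prepend_comp]
  · rintro ⟨U, Z, rfl, rfl, h⟩
    refine ⟨⟨b, prepend ν U.1, h𝓔.isBoundaryPath_prepend ν U.2⟩, prepends_mk_mk.2 rfl, ?_⟩
    rw [prepends_mk_mk, h, prepend_comp]

theorem exists_prepends (Λ : KGraph k V) {a x : V} {μ : a ⟶ x} {q : BoundarySpace 𝓔} :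
    (∃ p, Prepends μ p q) ↔ StartsWith q ⟨a, μ⟩ := by
  constructor
  · rintro ⟨p, U, W, rfl, rfl, h⟩
    rw [startsWith_mk, h]
    exact mem_prepend_self μ U.2
  · rintro ⟨W, rfl, hW⟩
    exact ⟨⟨a, shift μ W.1, isBoundaryPath_shift Λ W.2 hW⟩,
      prepends_mk_mk.2 (prepend_shift W.2 hW).symm⟩

theorem Prepends.startsWith {a x : V} {μ : a ⟶ x} {p q : BoundarySpace 𝓔}
    (h : Prepends μ p q) : StartsWith q ⟨a, μ⟩ := by
  obtain ⟨U, W, rfl, rfl, h⟩ := h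
  rw [startsWith_mk, h]
  exact mem_prepend_self μ U.2

theorem StartsWith.unique (Λ : KGraph k V) {x : V} {q : BoundarySpace 𝓔} {μ ν : PathsTo x}
    (hμ : StartsWith q μ) (hν : StartsWith q ν) (hd : Λ.d μ.2 = Λ.d ν.2) : μ = ν := by
  obtain ⟨W, rfl, hW⟩ := hμ
  rw [startsWith_mk] at hν
  obtain ⟨ρ, -, h1, h2⟩ := W.2.directed hW hν
  exact Λ.isPrefix_unique h1 h2 hd

/-- The Toeplitz relation at the level of boundary paths: a boundary path starting with both `μ` and
`ν` starts with a minimal common extension of them. -/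
theorem IsEfficient.prepends_minExt (h𝓔 : Λ.IsEfficient 𝓔) {a b x : V} (μ : a ⟶ x) (ν : b ⟶ x)
    {p q : BoundarySpace 𝓔} :
    (∃ w, Prepends ν p w ∧ Prepends μ q w) ↔
      ∃ m ∈ Λ.minExt μ ν, ∃ r, Prepends m.2.2 r p ∧ Prepends m.2.1 r q := by
  constructor
  · rintro ⟨w, hp, hq⟩
    obtain ⟨W, rfl, hμ⟩ := hq.startsWith
    have hν := startsWith_mk.1 hp.startsWith
    obtain ⟨ρ, hρ, h1, h2⟩ := W.2.directed hμ hν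
    -- Cutting the common extension `ρ` down to degree `d(μ) ∨ d(ν)` makes it minimal; `r` will be
    -- the tail of `w` after `σ`.
    obtain ⟨σ, hσ, hd⟩ := Λ.exists_prefix ρ
      (sup_le (IsPrefix.degree_le Λ h1) (IsPrefix.degree_le Λ h2))
    obtain ⟨α, hα⟩ := IsPrefix.of_degree_le Λ h1 hσ (by rw [hd]; exact le_sup_left)
    obtain ⟨β, hβ⟩ := IsPrefix.of_degree_le Λ h2 hσ (by rw [hd]; exact le_sup_right)
    dsimp only at α β hα hβ
    have hσW : StartsWith (⟨x, W⟩ : BoundarySpace 𝓔) ⟨σ.1, σ.2⟩ :=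
      startsWith_mk.2 (W.2.lower hσ hρ)
    obtain ⟨r, hr⟩ := (exists_prepends Λ).2 hσW
    refine ⟨⟨σ.1, α, β⟩, ⟨hα.trans hβ.symm, ?_⟩, r, ?_, ?_⟩
    · dsimp only
      rw [hα, hd]
    · rw [← hβ, ← h𝓔.prepends_comp] at hr
      obtain ⟨t, ht, ht'⟩ := hr
      rwa [hp.left_unique Λ ht']
    · rw [← hα, ← h𝓔.prepends_comp] at hr
      obtain ⟨t, ht, ht'⟩ := hr
      rwa [hq.left_unique Λ ht']
  · rintro ⟨⟨c, α, β⟩, ⟨hm, -⟩, r, hp, hq⟩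
    dsimp only at hm hp hq
    obtain ⟨U, W, rfl, rfl, hW⟩ := hp
    let w : BoundarySpace 𝓔 := ⟨x, prepend ν W.1, h𝓔.isBoundaryPath_prepend ν W.2⟩
    have hw : Prepends ν ⟨b, W⟩ w := prepends_mk_mk.2 rfl
    refine ⟨w, hw, ?_⟩
    have h1 : Prepends (β ≫ ν) ⟨c, U⟩ w :=
      (h𝓔.prepends_comp ν β).1 ⟨_, prepends_mk_mk.2 hW, hw⟩
    rw [← hm, ← h𝓔.prepends_comp] at h1
    obtain ⟨t, ht, ht'⟩ := h1
    rwa [hq.right_unique ht]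

/-- The partial bijection `p ↦ μp` of the space of boundary paths. -/
noncomputable def prependEquiv (Λ : KGraph k V) (𝓔 : ∀ x : V, Set (Finset (PathsTo x))) {a b : V}
    (μ : a ⟶ b) : BoundarySpace 𝓔 ≃. BoundarySpace 𝓔 :=
  PEquiv.ofRel (Prepends μ) (fun _ _ _ => Prepends.right_unique)
    (fun _ _ _ => Prepends.left_unique Λ)

theorem mem_prependEquiv {a b : V} {μ : a ⟶ b} {p q : BoundarySpace 𝓔} :
    q ∈ prependEquiv Λ 𝓔 μ p ↔ Prepends μ p q := PEquiv.mem_ofRel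

/-- The boundary path representation on the Hilbert space of the space of boundary paths. -/
noncomputable def boundaryFamily (Λ : KGraph k V) (𝓔 : ∀ x : V, Set (Finset (PathsTo x))) :
    PathFamily V (PEquiv.L2 (BoundarySpace 𝓔) →L[ℂ] PEquiv.L2 (BoundarySpace 𝓔)) :=
  fun _ _ μ => (prependEquiv Λ 𝓔 μ).toOp

theorem IsEfficient.isTCKFamily_boundaryFamily (hΛ : Λ.FinitelyAligned)
    (h𝓔 : Λ.IsEfficient 𝓔) : Λ.IsTCKFamily (boundaryFamily Λ 𝓔) where
  partialIsometry a b μ := by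
    rw [boundaryFamily, PEquiv.star_toOp, PEquiv.toOp_mul, PEquiv.toOp_mul]
    congr 1
    refine PEquiv.ext_mem fun p q => ?_
    simp only [PEquiv.mem_trans, PEquiv.mem_iff_mem, mem_prependEquiv]
    constructor
    · rintro ⟨q', h1, p', h2, h3⟩
      obtain rfl := Prepends.left_unique Λ h1 h2
      exact h3
    · exact fun h => ⟨q, h, p, h, h⟩
  projection x := by
    refine ⟨?_, ?_⟩
    · rw [IsIdempotentElem, boundaryFamily, PEquiv.toOp_mul]
      congr 1
      refine PEquiv.ext_mem fun p q => ?_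
      simp only [PEquiv.mem_trans, mem_prependEquiv, prepends_id]
      grind
    · rw [isSelfAdjoint_iff, boundaryFamily, PEquiv.star_toOp]
      congr 1
      refine PEquiv.ext_mem fun p q => ?_
      simp only [PEquiv.mem_iff_mem, mem_prependEquiv, prepends_id]
      grind
  orthogonal x y hxy := by
    simp only [boundaryFamily, PEquiv.toOp_mul]
    -- The composite partial bijection is empty, so its operator is an empty sum.
    rw [PEquiv.toOp_eq_sum (s := (∅ : Finset Empty)) (g := Empty.rec), Finset.sum_empty]
    · intro p q
      simp only [PEquiv.mem_trans, mem_prependEquiv, prepends_id]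
      grind
    · simp
  mul a b c μ ν := by
    simp only [boundaryFamily, PEquiv.toOp_mul]
    congr 1
    refine PEquiv.ext_mem fun p q => ?_
    simp only [PEquiv.mem_trans, mem_prependEquiv, h𝓔.prepends_comp]
  star_mul a b x μ ν := by
    rw [finsum_mem_eq_finite_toFinset_sum _ (hΛ μ ν)]
    simp only [boundaryFamily, PEquiv.star_toOp, PEquiv.toOp_mul]
    refine PEquiv.toOp_eq_sum (g := fun m : Σ c : V, (c ⟶ a) × (c ⟶ b) =>
      (prependEquiv Λ 𝓔 m.2.2).symm.trans (prependEquiv Λ 𝓔 m.2.1)) (fun p q => ?_) ?_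
    · simp only [PEquiv.mem_trans, PEquiv.mem_iff_mem, mem_prependEquiv,
        h𝓔.prepends_minExt, Set.Finite.mem_toFinset]
    · simp only [PEquiv.mem_trans, PEquiv.mem_iff_mem, mem_prependEquiv,
        Set.Finite.mem_toFinset]
      -- Ranges are disjoint because `α` and `α'` have the same degree and both start `q`, hence
      -- agree; then `β = β'` by cancelling `ν`.
      rintro ⟨c, α, β⟩ ⟨h1, h1d⟩ ⟨c', α', β'⟩ ⟨h2, h2d⟩ p p' q ⟨r, -, hr⟩ ⟨r', -, hr'⟩
      have hd : Λ.d α = Λ.d α' := by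
        have := h1d.trans h2d.symm
        simp only [Λ.d_comp] at this
        exact add_left_cancel this
      have hα := hr.startsWith.unique Λ hr'.startsWith hd
      rw [Sigma.mk.injEq] at hα
      obtain ⟨rfl, hα⟩ := hα
      obtain rfl := eq_of_heq hα
      have hβ : β = β' := Λ.cancel_right (h1.symm.trans h2)
      rw [hβ]
  star_mul_of_ne a b x y μ ν hxy := by
    simp only [boundaryFamily, PEquiv.star_toOp, PEquiv.toOp_mul]
    rw [PEquiv.toOp_eq_sum (s := (∅ : Finset Empty)) (g := Empty.rec), Finset.sum_empty]
    · intro p q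
      simp only [PEquiv.mem_trans, PEquiv.mem_iff_mem, mem_prependEquiv]
      constructor
      · rintro ⟨w, ⟨U, W, -, rfl, -⟩, ⟨U', W', -, h, -⟩⟩
        exact absurd (Sigma.mk.inj h).1.symm hxy
      · simp
    · simp

-- Every `T_e T_e^*` is multiplication by the indicator function of the boundary paths starting with
-- `e`, so the gap product is diagonal.
open Classical in
theorem gapProd_boundaryFamily_apply {x : V} (E : Finset (PathsTo x))
    (ξ : PEquiv.L2 (BoundarySpace 𝓔)) (q : BoundarySpace 𝓔) :
    gapProd (boundaryFamily Λ 𝓔) E ξ q =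
      if q.1 = x ∧ ∀ e ∈ E, ¬ StartsWith q e then ξ q else 0 := by
  have hv : ∀ (ξ : PEquiv.L2 (BoundarySpace 𝓔)) (q : BoundarySpace 𝓔),
      boundaryFamily Λ 𝓔 (𝟙 x) ξ q = if q.1 = x then ξ q else 0 := by
    intro ξ q
    rw [boundaryFamily, PEquiv.toOp_apply]
    split_ifs with h
    · exact PEquiv.transport_of_mem (mem_prependEquiv.2 (prepends_id.2 ⟨rfl, h⟩))
    · exact PEquiv.transport_of_forall_notMem fun p hp =>
        h (prepends_id.1 (mem_prependEquiv.1 hp)).2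
  have he : ∀ (e : PathsTo x) (ξ : PEquiv.L2 (BoundarySpace 𝓔)) (q : BoundarySpace 𝓔),
      (boundaryFamily Λ 𝓔 e.2 * star (boundaryFamily Λ 𝓔 e.2)) ξ q =
        if StartsWith q e then ξ q else 0 := by
    intro e ξ q
    rw [boundaryFamily, PEquiv.star_toOp, PEquiv.toOp_mul, PEquiv.toOp_apply]
    split_ifs with h
    · obtain ⟨p, hp⟩ := (exists_prepends Λ).2 h
      refine PEquiv.transport_of_mem ((PEquiv.mem_trans _ _ _ _).2 ⟨p, ?_, ?_⟩)
      · exact PEquiv.mem_iff_mem _ |>.2 (mem_prependEquiv.2 hp)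
      · exact mem_prependEquiv.2 hp
    · refine PEquiv.transport_of_forall_notMem fun p hp => h ?_
      obtain ⟨r, -, hr⟩ := (PEquiv.mem_trans _ _ _ _).1 hp
      exact (mem_prependEquiv.1 hr).startsWith
  simp only [← Finset.mem_toList, gapProd]
  induction E.toList with
  | nil => simpa using hv ξ q
  | cons e l ih =>
    have hx : StartsWith q e → q.1 = x := by
      rintro ⟨W, rfl, -⟩
      rfl
    rw [List.foldr_cons, mul_apply_eq_comp, sub_apply,
      lp.coeFn_sub, Pi.sub_apply, hv, he, ih]
    simp only [List.mem_cons, forall_eq_or_imp]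
    by_cases hq : q.1 = x
    · by_cases hs : StartsWith q e <;> simp [hq, hs]
    · simp [hq, mt hx hq]

theorem gapProd_boundaryFamily_eq_zero_iff {x : V}
    {E : Finset (PathsTo x)} : gapProd (boundaryFamily Λ 𝓔) E = 0 ↔
      ∀ U : Set (PathsTo x), IsBoundaryPath 𝓔 U → ∃ e ∈ E, e ∈ U := by
  classical
  constructor
  · intro h U hU
    by_contra! hne
    -- The point mass at a boundary path avoiding `E` is fixed by the gap product.
    have h1 := gapProd_boundaryFamily_apply (Λ := Λ) E
      (lp.single 2 (⟨x, U, hU⟩ : BoundarySpace 𝓔) (1 : ℂ)) ⟨x, U, hU⟩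
    rw [h, if_pos ⟨rfl, fun e he hs => hne e he (startsWith_mk.1 hs)⟩] at h1
    simp at h1
  · intro h
    ext ξ q
    rw [gapProd_boundaryFamily_apply, if_neg]
    · rfl
    · rintro ⟨rfl, hq⟩
      obtain ⟨x, U⟩ := q
      obtain ⟨e, he, heU⟩ := h U.1 U.2
      exact hq e he (startsWith_mk.2 heU)

theorem IsEfficient.isRelCKFamily_boundaryFamily (hΛ : Λ.FinitelyAligned)
    (h𝓔 : Λ.IsEfficient 𝓔) : Λ.IsRelCKFamily 𝓔 (boundaryFamily Λ 𝓔) where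
  toIsTCKFamily := h𝓔.isTCKFamily_boundaryFamily hΛ
  gapProd_eq_zero x E hE := by
    rw [gapProd_boundaryFamily_eq_zero_iff]
    intro U hU
    simpa [append] using hU.meets _ hU.id_mem E hE

/-- As the factors commute, those of `F` can be moved to the right end, where their product is zero.
-/
theorem IsTCKFamily.gapProd_eq_zero_of_subset (hΛ : Λ.FinitelyAligned) {A : Type w}
    [NonUnitalCStarAlgebra A] {T : PathFamily V A} (hT : Λ.IsTCKFamily T) {x : V}
    {E F : Finset (PathsTo x)} (hFE : F ⊆ E) (hF : gapProd T F = 0) : gapProd T E = 0 := by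
  classical
  have hperm : E.toList.Perm ((E \ F).toList ++ F.toList) := by
    rw [← Multiset.coe_eq_coe, ← Multiset.coe_add, Finset.coe_toList, Finset.coe_toList,
      Finset.coe_toList]
    conv_lhs => rw [← Finset.sdiff_union_of_subset hFE]
    rw [← Finset.disjUnion_eq_union _ _ Finset.sdiff_disjoint]
    rfl
  unfold gapProd at hF ⊢
  rw [hperm.foldr_eq' fun μ _ ν _ z => by
    rw [← mul_assoc, ← mul_assoc, (hT.gap_commute hΛ ν μ).eq], List.foldr_append, hF]
  induction (E \ F).toList with
  | nil => rfl
  | cons e l ih => rw [List.foldr_cons, ih, mul_zero]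

end KGraph

theorem mainTheorem6 {k : ℕ} {V : Type u} [Category.{v} V] (Λ : KGraph k V)
    (hΛ : Λ.FinitelyAligned) (𝓔 : ∀ x : V, Set (Finset (PathsTo x))) (h𝓔 : Λ.IsEfficient 𝓔)
    {A : Type w} [NonUnitalCStarAlgebra A] (s : PathFamily V A)
    (hs : Λ.IsUniversalFamily 𝓔 s) :
    (∀ x : V, s (𝟙 x) ≠ 0) ∧
    (∀ (x : V) (E : Finset (PathsTo x)), (∀ e ∈ E, Λ.IsEdge e.2) →
      (E ∈ Λ.edgeSatiation 𝓔 x ↔ gapProd s E = 0)) := by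
  have hiff : ∀ (x : V) (E : Finset (PathsTo x)), (∀ e ∈ E, Λ.IsEdge e.2) →
      (E ∈ Λ.edgeSatiation 𝓔 x ↔ gapProd s E = 0) := by
    intro x E hE
    constructor
    · rintro ⟨-, F, hF, hFE⟩
      exact hs.isRelCKFamily.toIsTCKFamily.gapProd_eq_zero_of_subset hΛ hFE
        (hs.isRelCKFamily.gapProd_eq_zero x F hF)
    · intro h0
      by_contra hnot
      obtain ⟨U, hU, hUE⟩ := h𝓔.exists_boundaryPath hE hnot
      -- The boundary space lies in `Type (max u v)`, so its operator algebra is among the targets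
      -- allowed by `lift`.
      obtain ⟨π, hπ⟩ := hs.lift _ (KGraph.boundaryFamily Λ 𝓔)
        (h𝓔.isRelCKFamily_boundaryFamily hΛ)
      have h1 : gapProd (KGraph.boundaryFamily Λ 𝓔) E = 0 := by
        have h2 := KGraph.map_gapProd π s E
        rw [h0, map_zero] at h2
        rw [h2]
        simp only [hπ]
      obtain ⟨e, he, heU⟩ := KGraph.gapProd_boundaryFamily_eq_zero_iff.1 h1 U hU
      exact hUE e he heU
  refine ⟨fun x h0 => ?_, hiff⟩
  have h1 : gapProd s (∅ : Finset (PathsTo x)) = 0 := by simpa [gapProd] using h0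
  obtain ⟨h2, -⟩ := (hiff x ∅ (by simp)).2 h1
  -- Exhaustiveness tested on the vertex itself would produce an element of `∅`.
  obtain ⟨ν, hν, -⟩ := h2.1.2 ⟨x, 𝟙 x⟩
  simp at hν
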